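/- Let $K$ be a field of characteristic zero and let $P(x,y)=\sum_{i=0}^{d_x}\sum_{j=0}^{d_y}a_{i,j}x^iy^j\in K[x,y]$ be a polynomial of degree at most $d_x$ in $x$ and at most $d_y$ in $y$. Let $y_0=\sum_{n\ge1}c_nx^n\in K[[x]]$, $c_1\neq0$, be a simple root of $P$, i.e. $P(x,y_0)=0$ and $\frac{\partial P}{\partial y}(x,y_0)\ne0$. For $k\in\mathbb N=\{0,1,2,\dots\}$ put $z_k:=\sum_{n=1}^kc_nx^n$ and write $P_k(x,y):=P(x,z_k+x^{k+1}y)=\sum_i\pi_{k,i}(y)x^i$; let $i_k$ be the least $i$ with $\pi_{k,i}\neq0$. Then there is a least $k_0\in\mathbb N$ with $i_{k_0+1}=i_{k_0}+1$, one has $\omega_0:=\pi_{k_0,i_{k_0}}'(c_{k_0+1})\neq0$, and for every $k\ge k_0+1$ and every $p\ge1$ $$c_{k+1+p}=\sum_{q=1}^p\frac1q\left(\frac{-1}{\omega_0}\right)^q\sum_{|S|=q,\ \|S\|_2\ge q-1}A^S\left(\sum_{\substack{|T|=\|S\|_2-q+1\\ \|T\|=p+qi_k-(q-1)(k+1)-\|S\|_1}}e_{S,T}\,C^{T}\right).$$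 Here $S=(s_{i,j})_{0\le i\le d_x,\,0\le j\le d_y}$ and $T=(t_1,\dots,t_{k+1})$ range over vectors of natural numbers, with $|S|=\sum s_{i,j}$, $\|S\|_1=\sum i\,s_{i,j}$, $\|S\|_2=\sum j\,s_{i,j}$, $A^S=\prod a_{i,j}^{s_{i,j}}$, $|T|=\sum t_i$, $\|T\|=\sum i\,t_i$, $C^T=\prod_{i=1}^{k+1}c_i^{t_i}$ (with $0^0=1$). The coefficients $e_{S,T}$ (written $e_{T_S}$ with $T=T_S$, as they depend on $S$ and $T$, as well as on $q,k,i_k,d_x,d_y$) are natural numbers, given as follows. Let $I$ be the finite set of all $(l,m,i,j,L)$ with $1\le l\le(k+1)d_y+d_x-i_k$, $\ 0\le m\le m_l:=\min\{\lfloor\frac{l+i_k}{k+1}\rfloor,d_y\}$, $\ 0\le i\le d_x$, $\ m\le j\le d_y$, and $L=(l_1,\dots,l_{k+1})\in\mathbb N^{k+1}$ with $|L|=j-m$ and $\|L\|=l+i_k-m(k+1)-i$ (where $|L|=\sum_r l_r$, $\|L\|=\sum_r r\,l_r$, $L!=\prod_r l_r!$). Then $$e_{S,T}=\sum_{(n^{l,m}_{i,j,L})}\frac{q!}{\prod_{I}n^{l,m}_{i,j,L}!}\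 \prod_{I}\left(\frac{j!}{m!\,L!}\right)^{n^{l,m}_{i,j,L}},$$ where the sum is over all families $(n^{l,m}_{i,j,L})_{(l,m,i,j,L)\in I}$ of natural numbers such that $$\sum_{I}n^{l,m}_{i,j,L}=q,\qquad \sum_{l,m}\sum_{L}n^{l,m}_{i,j,L}=s_{i,j}\ \text{ for all } i,j,\qquad \sum_{I}n^{l,m}_{i,j,L}\,L=T.$$ -/

import Mathlib

open Finset Polynomial
open scoped Nat Polynomial.Bivariate

namespace AlgSeries

section Newton

variable {K : Type*} [Field K]

/-- The truncation `z_k = ∑_{n=1}^k c_n x^n`, where `c_n` is the coefficient of `x^n` in `y₀`. -/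
noncomputable def trunc (y₀ : PowerSeries K) (k : ℕ) : K[X] :=
  ∑ n ∈ Icc 1 k, Polynomial.monomial n (PowerSeries.coeff n y₀)

/-- `P_k(x, y) = P(x, z_k + x^(k+1) y)`. The outer variable of `K[X][Y]` is `y`, the inner one
is `x`. -/
noncomputable def shifted (P : K[X][Y]) (y₀ : PowerSeries K) (k : ℕ) : K[X][Y] :=
  P.comp (Polynomial.C (trunc y₀ k)
    + Polynomial.C ((Polynomial.X : K[X]) ^ (k + 1)) * (Polynomial.X : K[X][Y]))

/-- The coefficient `π_i(y)` of `x^i` in `Q(x, y) = ∑_i π_i(y) x^i`, a polynomial in `y`. -/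
noncomputable def xCoeff (Q : K[X][Y]) (i : ℕ) : K[X] :=
  ∑ j ∈ Q.support, Polynomial.monomial j ((Q.coeff j).coeff i)

/-- `ord_x Q`: the least exponent of `x` that occurs in `Q` (the value at `Q = 0` is never
used). -/
noncomputable def xOrder (Q : K[X][Y]) : ℕ :=
  sInf {i : ℕ | ∃ j : ℕ, (Q.coeff j).coeff i ≠ 0}

/-- `i_k = ord_x P_k`. -/
noncomputable def xOrd (P : K[X][Y]) (y₀ : PowerSeries K) (k : ℕ) : ℕ :=
  xOrder (shifted P y₀ k)

/-- `π'_{k, i_k}(c_{k+1})`, where `π_{k, i}(y)` is the coefficient of `x^i` in `P_k`.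
For `k = k₀` this is `ω₀`. -/
noncomputable def omega (P : K[X][Y]) (y₀ : PowerSeries K) (k : ℕ) : K :=
  (derivative (xCoeff (shifted P y₀ k) (xOrd P y₀ k))).eval (PowerSeries.coeff (k + 1) y₀)

/-- The power series `Q(x, y₀(x))`. -/
noncomputable def subst (Q : K[X][Y]) (y₀ : PowerSeries K) : PowerSeries K :=
  Q.eval₂ Polynomial.coeToPowerSeries.ringHom y₀

/-- `y₀` is a simple root of `P`: `P(x, y₀) = 0` and `(∂P/∂y)(x, y₀) ≠ 0`. -/
def IsSimpleRoot (P : K[X][Y]) (y₀ : PowerSeries K) : Prop :=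
  subst P y₀ = 0 ∧ subst (derivative P) y₀ ≠ 0

/-- `A^S = ∏_{i ≤ d_x, j ≤ d_y} a_{i,j}^{s_{i,j}}`, with `a_{i,j}` the coefficient of `x^i y^j`
in `P`. -/
noncomputable def aPow (P : K[X][Y]) (dx dy : ℕ) (S : ℕ × ℕ →₀ ℕ) : K :=
  ∏ i ∈ range (dx + 1), ∏ j ∈ range (dy + 1), ((P.coeff j).coeff i) ^ S (i, j)

/-- `C^T = ∏_{i=1}^{k+1} c_i^{t_i}`. -/
noncomputable def cPow (y₀ : PowerSeries K) (k : ℕ) (T : ℕ →₀ ℕ) : K :=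
  ∏ i ∈ Icc 1 (k + 1), (PowerSeries.coeff i y₀) ^ T i

end Newton

section Indices

/-- `‖T‖ = ∑_i i t_i` for a vector `T = (t_1, …, t_{k+1})`. -/
def wt (k : ℕ) (T : ℕ →₀ ℕ) : ℕ := ∑ i ∈ Icc 1 (k + 1), i * T i

/-- `‖S‖₁ = ∑_{i,j} i s_{i,j}`. -/
def wt₁ (dx dy : ℕ) (S : ℕ × ℕ →₀ ℕ) : ℕ :=
  ∑ i ∈ range (dx + 1), ∑ j ∈ range (dy + 1), i * S (i, j)

/-- `‖S‖₂ = ∑_{i,j} j s_{i,j}`. -/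
def wt₂ (dx dy : ℕ) (S : ℕ × ℕ →₀ ℕ) : ℕ :=
  ∑ i ∈ range (dx + 1), ∑ j ∈ range (dy + 1), j * S (i, j)

/-- The vectors `S = (s_{i,j})`, `0 ≤ i ≤ d_x`, `0 ≤ j ≤ d_y`, of natural numbers with `|S| = q`
and `‖S‖₂ ≥ q - 1`. -/
noncomputable def sIndices (dx dy q : ℕ) : Finset (ℕ × ℕ →₀ ℕ) :=
  (finsuppAntidiag (range (dx + 1) ×ˢ range (dy + 1)) q).filter
    fun S => q - 1 ≤ wt₂ dx dy S

/-- The vectors `T = (t_1, …, t_{k+1})` of natural numbers with `|T| = ‖S‖₂ - q + 1` and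
`‖T‖ = p + q i_k - (q - 1)(k + 1) - ‖S‖₁`; here `ik` stands for `i_k`. It is used for
`1 ≤ q ≤ ‖S‖₂ + 1` only, so that the subtraction of natural numbers is a true one. -/
noncomputable def tIndices (dx dy k ik p q : ℕ) (S : ℕ × ℕ →₀ ℕ) : Finset (ℕ →₀ ℕ) :=
  (finsuppAntidiag (Icc 1 (k + 1)) (wt₂ dx dy S + 1 - q)).filter
    fun T => (wt k T : ℤ) = p + q * ik - (q - 1) * (k + 1) - wt₁ dx dy S

/-- An index `(l, m, i, j, L)` of the family `n^{l,m}_{i,j,L}`. -/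
structure TermIndex where
  l : ℕ
  m : ℕ
  i : ℕ
  j : ℕ
  L : ℕ →₀ ℕ
  deriving DecidableEq

/-- The finite set of indices `(l, m, i, j, L)` with `1 ≤ l ≤ (k+1) d_y + d_x - i_k`,
`0 ≤ m ≤ m_l = min (⌊(l + i_k)/(k+1)⌋, d_y)`, `0 ≤ i ≤ d_x`, `m ≤ j ≤ d_y`,
`L = (l_1, …, l_{k+1})`, `|L| = j - m` and `‖L‖ = l + i_k - m (k+1) - i`. -/
noncomputable def termIndices (dx dy k ik : ℕ) : Finset TermIndex :=
  (Icc 1 ((k + 1) * dy + dx - ik)).biUnion fun l =>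
  (Icc 0 (min ((l + ik) / (k + 1)) dy)).biUnion fun m =>
  (Icc 0 dx).biUnion fun i =>
  (Icc m dy).biUnion fun j =>
    ((finsuppAntidiag (Icc 1 (k + 1)) (j - m)).filter
      fun L => (wt k L : ℤ) = l + ik - m * (k + 1) - i).image
        fun L => (⟨l, m, i, j, L⟩ : TermIndex)

open scoped Classical in
/-- The families `n = (n^{l,m}_{i,j,L})` of natural numbers such that `∑ n^{l,m}_{i,j,L} = q`,
`∑_{l,m} ∑_L n^{l,m}_{i,j,L} = s_{i,j}` for all `i, j`, and `∑ n^{l,m}_{i,j,L} L = T`. -/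
noncomputable def families (dx dy k ik q : ℕ) (S : ℕ × ℕ →₀ ℕ) (T : ℕ →₀ ℕ) :
    Finset (TermIndex →₀ ℕ) :=
  (finsuppAntidiag (termIndices dx dy k ik) q).filter fun n =>
    (∀ i ∈ Icc 0 dx, ∀ j ∈ Icc 0 dy,
      ∑ x ∈ (termIndices dx dy k ik).filter (fun x => x.i = i ∧ x.j = j), n x = S (i, j)) ∧
    ∑ x ∈ termIndices dx dy k ik, n x • x.L = T

/-- The coefficient `e_{T_S}`, defined as a rational number:
`∑_n q! / (∏ n^{l,m}_{i,j,L}!) * ∏ (j! / (m! L!)) ^ n^{l,m}_{i,j,L}`. -/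
noncomputable def eCoeff (dx dy k ik q : ℕ) (S : ℕ × ℕ →₀ ℕ) (T : ℕ →₀ ℕ) : ℚ :=
  ∑ n ∈ families dx dy k ik q S T,
    (q ! : ℚ) / (∏ x ∈ termIndices dx dy k ik, ((n x)! : ℚ)) *
      ∏ x ∈ termIndices dx dy k ik,
        ((x.j ! : ℚ) / ((x.m ! : ℚ) * ∏ r ∈ Icc 1 (k + 1), ((x.L r)! : ℚ))) ^ n x

end Indices

end AlgSeries

/-!
Write `P(x, y₀ + u) = ∑_m b_m(x) u^m` over `K[[x]]`. As `y₀` is a simple root, `b_0 = 0` and `b_1` is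
nonzero, of some order `β`. The substitution `y = (y₀ - z_k) / x^(k+1) + u` is an automorphism of
`K[[x]][y]` fixing `x`, and turns `P_k` into `∑_m b_m x^(m(k+1)) u^m`; hence
`i_k = min_m (ord b_m + m (k + 1))` (`le_xOrd_iff`). The minimum of these affine functions of `k`
increases by one from `k` to `k + 1` exactly when `m = 1` attains it at `k` (`xOrd_succ_eq_iff`),
which happens for `k` large and then persists. From `k₀ + 1` on it is attained by `m = 1` only, and
`ω₀` is the leading coefficient of `b_1` (`omega_eq_coeff`).

For such `k`, therefore, `P_k(x, c_{k+1} + v)` is `ω₀ x^(i_k) v` up to higher powers of `x`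
(`coeff_recentered`). Its other terms, read off from the multinomial expansion of
`P(x, z_{k+1} + x^(k+1) v)`, are indexed by `termIndices` (`recentered_eq_add_sum`). Dividing by
`ω₀ x^(i_k)`, the remainder `v = ∑_{p ≥ 1} c_{k+1+p} x^p` of the root satisfies `v = Q(x, v)` with a
polynomial `Q` divisible by `x` (`eval_fixedPointPoly`). Lagrange inversion
(`pow_dvd_sub_sum_lagrange`) gives `c_{k+1+p} = ∑_q (1/q) [x^p v^(q-1)] Q^q`, and expanding `Q^q` by
the multinomial theorem and sorting its terms by the vectors `S` and `T` (`sum_families`) yields the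
formula.

Lagrange inversion itself is proved with the functional `Λ(F) = ∑_{q < N} [X^q] (F Q^q)`. Modulo
`x^N` it kills the multiples of `X - Q(X)` by telescoping, hence also those of `X - v`, because
`X - v ≡ Q(X) - Q(v)` is `x` times a multiple of `X - v`. So `Λ(X (1 - Q')) ≡ v Λ(1 - Q')`; by
telescoping, `Λ(1 - Q') ≡ 1`, and the left-hand side is the sum in the Lagrange formula.
-/

namespace AlgSeries

/-! ### Lagrange inversion -/

section Lagrange

variable {R : Type*} [CommRing R]

/-- The linear functional `F ↦ ∑_{q < N} [X^q] (F Q^q)`. Up to a high power of an ideal containing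
the coefficients of `Q`, it is a multiple of evaluation at the fixed point of `Q`. -/
noncomputable def diagSum (Q : R[X]) (N : ℕ) : R[X] →ₗ[R] R :=
  ∑ q ∈ range N, lcoeff R q ∘ₗ LinearMap.mulRight R (Q ^ q)

theorem diagSum_apply (Q : R[X]) (N : ℕ) (F : R[X]) :
    diagSum Q N F = ∑ q ∈ range N, (F * Q ^ q).coeff q := by
  simp [diagSum]

theorem diagSum_mul_X_sub (Q : R[X]) (N : ℕ) (F : R[X]) :
    diagSum Q N (F * (X - Q)) = -(X * (F * Q ^ N)).coeff N := by
  have h : ∀ q, (F * (X - Q) * Q ^ q).coeff q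
      = (X * (F * Q ^ q)).coeff q - (X * (F * Q ^ (q + 1))).coeff (q + 1) := fun q => by
    rw [coeff_X_mul, ← coeff_sub]
    congr 1
    ring
  rw [diagSum_apply, sum_congr rfl fun q _ => h q,
    sum_range_sub' fun q => ((X : R[X]) * (F * Q ^ q)).coeff q]
  simp

variable [Algebra ℚ R]

theorem coeff_derivative_mul_pow (Q : R[X]) (q r : ℕ) :
    (derivative Q * Q ^ q).coeff r
      = ((r + 1 : ℚ) / (q + 1)) • (Q ^ (q + 1)).coeff (r + 1) := by
  have h : (derivative (Q ^ (q + 1))).coeff r = (q + 1 : ℚ) • (derivative Q * Q ^ q).coeff r := by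
    rw [derivative_pow_succ, mul_assoc, mul_comm (Q ^ q), Algebra.smul_def]
    have : (C ((q : R) + 1)) = C (algebraMap ℚ R (q + 1)) := by simp
    rw [this, coeff_C_mul]
  have h2 : (derivative (Q ^ (q + 1))).coeff r = (r + 1 : ℚ) • (Q ^ (q + 1)).coeff (r + 1) := by
    rw [coeff_derivative, Algebra.smul_def, mul_comm]
    simp
  have hq : (q + 1 : ℚ) ≠ 0 := by positivity
  rw [div_eq_inv_mul, mul_smul, ← h2, h, smul_smul, inv_mul_cancel₀ hq, one_smul]

theorem diagSum_one_sub_derivative (Q : R[X]) (N : ℕ) :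
    diagSum Q N (1 - derivative Q) = 1 - (Q ^ N).coeff N := by
  have h : ∀ q, ((1 - derivative Q) * Q ^ q).coeff q
      = (Q ^ q).coeff q - (Q ^ (q + 1)).coeff (q + 1) := fun q => by
    have hq : (q + 1 : ℚ) ≠ 0 := by positivity
    rw [sub_mul, one_mul, coeff_sub, coeff_derivative_mul_pow, div_self hq, one_smul]
  rw [diagSum_apply, sum_congr rfl fun q _ => h q, sum_range_sub' fun q => (Q ^ q).coeff q]
  simp

theorem diagSum_X_mul_one_sub_derivative (Q : R[X]) (N : ℕ) :
    diagSum Q N (X * (1 - derivative Q))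
      = ∑ q ∈ range N, (1 / q : ℚ) • (X * Q ^ q).coeff q
        - (1 - 1 / N : ℚ) • (X * Q ^ N).coeff N := by
  have h : ∀ q : ℕ, (X * (1 - derivative Q) * Q ^ q).coeff q
      = (X * Q ^ q).coeff q - (1 - 1 / (q + 1) : ℚ) • (X * Q ^ (q + 1)).coeff (q + 1) := by
    intro q
    have e : X * (1 - derivative Q) * Q ^ q = X * Q ^ q - X * (derivative Q * Q ^ q) := by ring
    rw [e, coeff_sub, coeff_X_mul]
    congr 1
    cases q with
    | zero => simp
    | succ r =>
      rw [coeff_X_mul, coeff_derivative_mul_pow]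
      congr 1
      push_cast
      have : (r + 1 + 1 : ℚ) ≠ 0 := by positivity
      field_simp
      ring
  rw [diagSum_apply]
  induction N with
  | zero => simp
  | succ N ih =>
    rw [sum_range_succ, ih, h, sum_range_succ]
    push_cast
    module

/-- **Lagrange inversion**, `x`-adically: if `v = Q(v)` and `x` divides `Q`, then
`v = ∑_{q ≥ 1} (1/q) [X^(q-1)] Q^q`. The coefficient `[X^(q-1)] Q^q` is written `[X^q] (X Q^q)`,
which vanishes at `q = 0`. -/
theorem pow_dvd_sub_sum_lagrange (x v : R) (Q₁ : R[X]) (hv : (C x * Q₁).eval v = v) (N : ℕ) :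
    x ^ N ∣ v - ∑ q ∈ range N, (1 / q : ℚ) • (X * (C x * Q₁) ^ q).coeff q := by
  set Q := C x * Q₁ with hQ
  have hpow : ∀ (F : R[X]) n, x ^ N ∣ (F * Q ^ N).coeff n := fun F n => by
    rw [hQ, mul_pow, ← C_pow, mul_left_comm, coeff_C_mul]
    exact dvd_mul_right _ _
  obtain ⟨D, hD⟩ := X_sub_C_dvd_sub_C_eval (a := v) (p := Q₁)
  -- Modulo the kernel of the functional, `X - v` is `x` times a multiple of itself.
  have hstep : X - C v = (X - Q) + C x * (D * (X - C v)) := by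
    have : C v = C x * C (Q₁.eval v) := by rw [← C_mul]; congr 1; simpa [hQ] using hv.symm
    rw [mul_comm D, ← hD, mul_sub, ← this]
    ring
  have key : ∀ n ≤ N, ∀ H, x ^ n ∣ diagSum Q N (H * (X - C v)) := by
    intro n
    induction n with
    | zero => simp
    | succ n ih =>
      intro hn H
      have e : H * (X - C v) = H * (X - Q) + x • (H * D * (X - C v)) := by
        rw [smul_eq_C_mul]
        conv_lhs => rw [hstep]
        ring
      rw [e, map_add, map_smul, diagSum_mul_X_sub, smul_eq_mul, pow_succ']
      refine dvd_add ?_ (mul_dvd_mul_left _ (ih (by omega) _))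
      rw [← pow_succ', dvd_neg, ← mul_assoc]
      exact (pow_dvd_pow x hn).trans (hpow _ _)
  have h1 := key N le_rfl (1 - derivative Q)
  have e : (1 - derivative Q) * (X - C v) = X * (1 - derivative Q) - v • (1 - derivative Q) := by
    rw [smul_eq_C_mul]; ring
  rw [e, map_sub, map_smul, diagSum_one_sub_derivative, diagSum_X_mul_one_sub_derivative,
    smul_eq_mul] at h1
  have h2 : x ^ N ∣ (1 - 1 / N : ℚ) • (X * Q ^ N).coeff N := by
    rw [Algebra.smul_def]; exact (hpow _ _).mul_left _
  have h3 : x ^ N ∣ v * (Q ^ N).coeff N := by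
    simpa using (hpow 1 N).mul_left v
  have := (h1.add h2).sub h3
  rw [← dvd_neg]
  convert this using 1
  ring

end Lagrange

/-! ### The Newton process read off from the Taylor expansion at the root -/

section Taylor

variable {R : Type*} [CommRing R]

theorem taylor_comp_linear (G : R[X]) (z s t y : R) (h : z + s * t = y) :
    taylor t (G.comp (C z + C s * X)) = (taylor y G).comp (C s * X) := by
  simp only [taylor_apply, comp_assoc]
  congr 1
  simp only [add_comp, mul_comp, C_comp, X_comp, ← h, C_add, C_mul]
  ring

theorem C_dvd_taylor_iff (a t : R) (G : R[X]) : C a ∣ taylor t G ↔ C a ∣ G := by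
  have h : ∀ (t : R) (G : R[X]), C a ∣ G → C a ∣ taylor t G := by
    rintro t _ ⟨H, rfl⟩
    exact ⟨taylor t H, by rw [← smul_eq_C_mul, map_smul, smul_eq_C_mul]⟩
  refine ⟨fun hG => ?_, h t G⟩
  simpa [taylor_taylor] using h (-t) _ hG

end Taylor

section Newton

variable {K : Type*} [Field K]

/-- The series `∑_n c_{n+k} x^n`, where `c_n` is the coefficient of `x^n` in `y₀`. -/
noncomputable def tail (y₀ : PowerSeries K) (k : ℕ) : PowerSeries K :=
  PowerSeries.mk fun n => PowerSeries.coeff (n + k) y₀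

/-- The polynomial `Q ∈ K[x][y]` viewed in `K[[x]][y]`. -/
noncomputable def toSeries (Q : K[X][Y]) : (PowerSeries K)[X] :=
  Q.map Polynomial.coeToPowerSeries.ringHom

/-- The coefficient `b_m` of `u^m` in the Taylor expansion `P(x, y₀ + u) = ∑_m b_m(x) u^m`. -/
noncomputable def taylorSeries (P : K[X][Y]) (y₀ : PowerSeries K) (m : ℕ) : PowerSeries K :=
  (taylor y₀ (toSeries P)).coeff m

theorem coeff_toSeries (Q : K[X][Y]) (m n : ℕ) :
    PowerSeries.coeff n ((toSeries Q).coeff m) = (Q.coeff m).coeff n := by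
  simp [toSeries, coeff_map]

theorem coe_trunc_add_tail (y₀ : PowerSeries K) (hc₀ : PowerSeries.coeff 0 y₀ = 0) (k : ℕ) :
    (trunc y₀ k : PowerSeries K) + PowerSeries.X ^ (k + 1) * tail y₀ (k + 1) = y₀ := by
  ext n
  simp only [trunc, map_add, Polynomial.coeff_coe, finsetSum_coeff, coeff_monomial,
    PowerSeries.coeff_X_pow_mul', tail, PowerSeries.coeff_mk, sum_ite_eq', mem_Icc]
  by_cases h : k + 1 ≤ n
  · rw [if_neg (by omega), if_pos h, zero_add, Nat.sub_add_cancel h]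
  · rcases Nat.eq_zero_or_pos n with rfl | h0
    · simp [hc₀]
    · rw [if_pos (by omega), if_neg h, add_zero]

theorem toSeries_comp (P : K[X][Y]) (z : K[X]) (s : ℕ) :
    toSeries (P.comp (C z + C ((X : K[X]) ^ s) * X))
      = (toSeries P).comp (C (z : PowerSeries K) + C (PowerSeries.X ^ s) * X) := by
  simp [toSeries, map_comp]

theorem subst_eq_eval (Q : K[X][Y]) (y₀ : PowerSeries K) : subst Q y₀ = (toSeries Q).eval y₀ := by
  rw [subst, toSeries, eval_map]

theorem taylorSeries_zero (P : K[X][Y]) (y₀ : PowerSeries K) :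
    taylorSeries P y₀ 0 = subst P y₀ := by
  rw [taylorSeries, taylor_coeff_zero, subst_eq_eval]

theorem taylorSeries_one (P : K[X][Y]) (y₀ : PowerSeries K) :
    taylorSeries P y₀ 1 = subst (derivative P) y₀ := by
  rw [taylorSeries, taylor_coeff_one, subst_eq_eval, toSeries, toSeries, derivative_map]

/-- After the substitution `y = (y₀ - z_k) / x^(k+1) + u`, the polynomial `P_k` becomes
`∑_m b_m x^(m(k+1)) u^m`. -/
theorem coeff_taylor_shifted (P : K[X][Y]) (y₀ : PowerSeries K)
    (hc₀ : PowerSeries.coeff 0 y₀ = 0) (k m : ℕ) :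
    (taylor (tail y₀ (k + 1)) (toSeries (shifted P y₀ k))).coeff m
      = taylorSeries P y₀ m * PowerSeries.X ^ (m * (k + 1)) := by
  rw [shifted, toSeries_comp, taylor_comp_linear _ _ _ _ _ (coe_trunc_add_tail y₀ hc₀ k),
    comp_C_mul_X_coeff, taylorSeries, ← pow_mul, mul_comm m]

theorem shifted_ne_zero {P : K[X][Y]} (hP : P ≠ 0) (y₀ : PowerSeries K) (k : ℕ) :
    shifted P y₀ k ≠ 0 := by
  intro h
  rw [shifted, comp_eq_zero_iff] at h
  rcases h with h | ⟨-, h⟩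
  · exact hP h
  · have := congrArg (fun Q : K[X][Y] => Q.coeff 1) h
    simp only [coeff_add, coeff_C_mul, coeff_X_one, coeff_C_succ, mul_one, zero_add] at this
    exact pow_ne_zero _ X_ne_zero this

theorem le_xOrder_iff {Q : K[X][Y]} (hQ : Q ≠ 0) (n : ℕ) :
    n ≤ xOrder Q ↔ C (PowerSeries.X ^ n) ∣ toSeries Q := by
  have hne : {i : ℕ | ∃ j : ℕ, (Q.coeff j).coeff i ≠ 0}.Nonempty := by
    by_contra h
    rw [Set.not_nonempty_iff_eq_empty, Set.eq_empty_iff_forall_notMem] at h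
    refine hQ (Polynomial.ext fun j => Polynomial.ext fun i => ?_)
    by_contra h'
    exact h i ⟨j, h'⟩
  simp only [C_dvd_iff_dvd_coeff, PowerSeries.X_pow_dvd_iff, coeff_toSeries]
  rw [xOrder, le_csInf_iff ⟨0, fun _ _ => Nat.zero_le _⟩ hne]
  constructor
  · intro h j i hi
    by_contra h'
    exact absurd (h i ⟨j, h'⟩) (by omega)
  · rintro h i ⟨j, hj⟩
    by_contra! h'
    exact hj (h j i h')

/-- The order `i_k` is the minimum over `m` of `ord b_m + m (k + 1)`. -/
theorem le_xOrd_iff {P : K[X][Y]} (hP : P ≠ 0) {y₀ : PowerSeries K}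
    (hc₀ : PowerSeries.coeff 0 y₀ = 0) (k n : ℕ) :
    n ≤ xOrd P y₀ k ↔
      ∀ m, PowerSeries.X ^ n ∣ taylorSeries P y₀ m * PowerSeries.X ^ (m * (k + 1)) := by
  rw [xOrd, le_xOrder_iff (shifted_ne_zero hP y₀ k), ← C_dvd_taylor_iff _ (tail y₀ (k + 1)),
    C_dvd_iff_dvd_coeff]
  simp only [coeff_taylor_shifted P y₀ hc₀]

theorem xCoeff_coeff (Q : K[X][Y]) (i j : ℕ) : (xCoeff Q i).coeff j = (Q.coeff j).coeff i := by
  simp only [xCoeff, finsetSum_coeff, coeff_monomial, sum_ite_eq']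
  split_ifs with h
  · rfl
  · simp [notMem_support_iff.mp h]

/-- Over `K[[x]]`, `P_k = x^(i_k) H`, so `π_{k, i_k}` is `H` at `x = 0`, and its derivative at `c_{k+1}`
is the value at `x = 0` of the linear Taylor coefficient of `H` at `(y₀ - z_k) / x^(k+1)`. -/
theorem omega_eq {P : K[X][Y]} (hP : P ≠ 0) {y₀ : PowerSeries K}
    (hc₀ : PowerSeries.coeff 0 y₀ = 0) (k : ℕ) :
    omega P y₀ k
      = PowerSeries.coeff (xOrd P y₀ k) (taylorSeries P y₀ 1 * PowerSeries.X ^ (k + 1)) := by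
  obtain ⟨H, hH⟩ := (le_xOrder_iff (shifted_ne_zero hP y₀ k) _).mp le_rfl
  have e : xCoeff (shifted P y₀ k) (xOrd P y₀ k) = H.map PowerSeries.constantCoeff := by
    ext j
    rw [xCoeff_coeff, coeff_map, ← coeff_toSeries, hH, coeff_C_mul]
    simpa [xOrd] using PowerSeries.coeff_X_pow_mul (H.coeff j) (xOrder (shifted P y₀ k)) 0
  have hc : PowerSeries.coeff (k + 1) y₀ = PowerSeries.constantCoeff (tail y₀ (k + 1)) := by
    simp [tail]
  have h1 := coeff_taylor_shifted P y₀ hc₀ k 1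
  rw [hH, ← smul_eq_C_mul, map_smul, coeff_smul, taylor_coeff_one, one_mul, smul_eq_mul] at h1
  rw [omega, e, derivative_map, hc, eval_map_apply, ← h1]
  simpa [xOrd] using (PowerSeries.coeff_X_pow_mul (H.derivative.eval (tail y₀ (k + 1)))
    (xOrder (shifted P y₀ k)) 0).symm

theorem xOrd_le {P : K[X][Y]} (hP : P ≠ 0) {y₀ : PowerSeries K}
    (hc₀ : PowerSeries.coeff 0 y₀ = 0) {β : ℕ}
    (hβ : PowerSeries.coeff β (taylorSeries P y₀ 1) ≠ 0) (k : ℕ) :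
    xOrd P y₀ k ≤ β + (k + 1) := by
  by_contra! h
  have h1 := (le_xOrd_iff hP hc₀ k _).mp le_rfl 1
  rw [PowerSeries.X_pow_dvd_iff] at h1
  have h2 := h1 _ h
  rw [one_mul, PowerSeries.coeff_mul_X_pow] at h2
  exact hβ h2

theorem X_pow_add_dvd_mul {b : PowerSeries K} {n m k r : ℕ} (hr : r ≤ m)
    (h : PowerSeries.X ^ n ∣ b * PowerSeries.X ^ (m * k)) :
    PowerSeries.X ^ (n + r) ∣ b * PowerSeries.X ^ (m * (k + 1)) := by
  rw [mul_add_one, pow_add, pow_add, ← mul_assoc]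
  exact mul_dvd_mul h (pow_dvd_pow _ hr)

/-- Passing from `k` to `k + 1` raises the order by exactly one when the linear Taylor coefficient,
of order `β`, already attains the minimum at `k`: the terms with `m ≥ 2` grow by at least two. -/
theorem xOrd_succ_eq_iff {P : K[X][Y]} (hP : P ≠ 0) {y₀ : PowerSeries K}
    (hc₀ : PowerSeries.coeff 0 y₀ = 0) (h₀ : taylorSeries P y₀ 0 = 0) {β : ℕ}
    (hd : PowerSeries.X ^ β ∣ taylorSeries P y₀ 1)
    (hβ : PowerSeries.coeff β (taylorSeries P y₀ 1) ≠ 0) (k : ℕ) :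
    xOrd P y₀ (k + 1) = xOrd P y₀ k + 1 ↔ xOrd P y₀ k = β + (k + 1) := by
  have hk := (le_xOrd_iff hP hc₀ k _).mp le_rfl
  constructor
  · intro h
    by_contra hne
    have hlt := lt_of_le_of_ne (xOrd_le hP hc₀ hβ k) hne
    suffices xOrd P y₀ k + 2 ≤ xOrd P y₀ (k + 1) by omega
    rw [le_xOrd_iff hP hc₀]
    rintro (_ | _ | m)
    · simp [h₀]
    · refine (pow_dvd_pow _ (?_ : _ ≤ β + (0 + 1) * (k + 1 + 1))).trans ?_
      · omega
      · rw [pow_add]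
        exact mul_dvd_mul hd dvd_rfl
    · exact X_pow_add_dvd_mul (by omega) (hk _)
  · intro h
    refine le_antisymm ?_ ?_
    · have := xOrd_le hP hc₀ hβ (k + 1)
      omega
    · rw [le_xOrd_iff hP hc₀]
      rintro (_ | m)
      · simp [h₀]
      · exact X_pow_add_dvd_mul (by omega) (hk _)

theorem xOrd_eq_of_large {P : K[X][Y]} (hP : P ≠ 0) {y₀ : PowerSeries K}
    (hc₀ : PowerSeries.coeff 0 y₀ = 0) (h₀ : taylorSeries P y₀ 0 = 0) {β : ℕ}
    (hd : PowerSeries.X ^ β ∣ taylorSeries P y₀ 1)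
    (hβ : PowerSeries.coeff β (taylorSeries P y₀ 1) ≠ 0) :
    xOrd P y₀ β = β + (β + 1) := by
  refine le_antisymm (xOrd_le hP hc₀ hβ β) ?_
  rw [le_xOrd_iff hP hc₀]
  -- For `m ≥ 2`, already `m (β + 1) ≥ β + (β + 1)`.
  rintro (_ | _ | m)
  · simp [h₀]
  · rw [pow_add]
    exact mul_dvd_mul hd (by simp)
  · refine dvd_mul_of_dvd_right (pow_dvd_pow _ ?_) _
    nlinarith

theorem omega_eq_coeff {P : K[X][Y]} (hP : P ≠ 0) {y₀ : PowerSeries K}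
    (hc₀ : PowerSeries.coeff 0 y₀ = 0) {β k : ℕ} (h : xOrd P y₀ k = β + (k + 1)) :
    omega P y₀ k = PowerSeries.coeff β (taylorSeries P y₀ 1) := by
  rw [omega_eq hP hc₀, h, PowerSeries.coeff_mul_X_pow]

theorem xOrd_eq_of_le {P : K[X][Y]} (hP : P ≠ 0) {y₀ : PowerSeries K}
    (hc₀ : PowerSeries.coeff 0 y₀ = 0) (h₀ : taylorSeries P y₀ 0 = 0) {β : ℕ}
    (hd : PowerSeries.X ^ β ∣ taylorSeries P y₀ 1)
    (hβ : PowerSeries.coeff β (taylorSeries P y₀ 1) ≠ 0) {k₀ k : ℕ}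
    (hk₀ : xOrd P y₀ k₀ = β + (k₀ + 1)) (hk : k₀ ≤ k) : xOrd P y₀ k = β + (k + 1) := by
  induction k, hk using Nat.le_induction with
  | base => exact hk₀
  | succ k _ ih =>
    have := (xOrd_succ_eq_iff hP hc₀ h₀ hd hβ k).mpr ih
    omega

/-- The polynomial `P(x, z_{k+1} + x^(k+1) v)`, that is `P_k(x, c_{k+1} + v)`. -/
noncomputable def recentered (P : K[X][Y]) (y₀ : PowerSeries K) (k : ℕ) : K[X][Y] :=
  P.comp (C (trunc y₀ (k + 1)) + C ((X : K[X]) ^ (k + 1)) * X)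

theorem trunc_succ_add_tail (y₀ : PowerSeries K) (hc₀ : PowerSeries.coeff 0 y₀ = 0) (k : ℕ) :
    (trunc y₀ (k + 1) : PowerSeries K)
      + PowerSeries.X ^ (k + 1) * (PowerSeries.X * tail y₀ (k + 2)) = y₀ := by
  rw [← mul_assoc, ← pow_succ]
  exact coe_trunc_add_tail y₀ hc₀ (k + 1)

theorem eval_recentered (P : K[X][Y]) (y₀ : PowerSeries K)
    (hc₀ : PowerSeries.coeff 0 y₀ = 0) (k : ℕ) :
    (toSeries (recentered P y₀ k)).eval (PowerSeries.X * tail y₀ (k + 2)) = subst P y₀ := by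
  rw [recentered, toSeries_comp, eval_comp, subst_eq_eval]
  congr 1
  simpa using trunc_succ_add_tail y₀ hc₀ k

/-- Once the linear Taylor coefficient strictly dominates, `P_k(x, c_{k+1} + v)` is
`ω x^(i_k) v` up to higher powers of `x`. -/
theorem coeff_recentered {P : K[X][Y]} (hP : P ≠ 0) {y₀ : PowerSeries K}
    (hc₀ : PowerSeries.coeff 0 y₀ = 0) (h₀ : taylorSeries P y₀ 0 = 0) {β : ℕ}
    (hd : PowerSeries.X ^ β ∣ taylorSeries P y₀ 1) {k : ℕ}
    (hk : xOrd P y₀ k = β + (k + 1)) {N : ℕ} (hN : N ≤ β + (k + 2)) (m : ℕ) :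
    ((recentered P y₀ (k + 1)).coeff m).coeff N
      = if m = 1 ∧ N = β + (k + 2) then PowerSeries.coeff β (taylorSeries P y₀ 1) else 0 := by
  set v := PowerSeries.X * tail y₀ (k + 1 + 2) with hv
  set ω := PowerSeries.coeff β (taylorSeries P y₀ 1)
  set a : PowerSeries K := PowerSeries.C ω * PowerSeries.X ^ (β + (k + 2))
  set F := toSeries (recentered P y₀ (k + 1))
  have hF : taylor v F = (taylor y₀ (toSeries P)).comp (C (PowerSeries.X ^ (k + 2)) * X) := by
    rw [show F = _ from toSeries_comp P _ _]
    exact taylor_comp_linear _ _ _ _ _ (trunc_succ_add_tail y₀ hc₀ (k + 1))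
  have hdvd : C (PowerSeries.X ^ (β + (k + 2) + 1)) ∣ F - C a * X := by
    rw [← C_dvd_taylor_iff _ v, C_dvd_iff_dvd_coeff]
    -- The constant term `a v` is negligible, as `x` divides `v`.
    have hav : PowerSeries.X ^ (β + (k + 2) + 1) ∣ a * v :=
      ⟨PowerSeries.C ω * tail y₀ (k + 1 + 2), by simp only [a, v]; ring⟩
    intro j
    rw [map_sub, coeff_sub, hF, comp_C_mul_X_coeff, taylor_mul, taylor_C, taylor_X, coeff_C_mul,
      coeff_add, ← pow_mul]
    change _ ∣ taylorSeries P y₀ j * _ - _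
    match j with
    | 0 => simpa [h₀] using hav
    | 1 =>
      obtain ⟨u, hu⟩ := hd
      have hω : ω = PowerSeries.constantCoeff u := by
        simpa [ω, hu] using PowerSeries.coeff_X_pow_mul u β 0
      have hX : PowerSeries.X ∣ u - PowerSeries.C ω := by
        rw [PowerSeries.X_dvd_iff]; simp [hω]
      obtain ⟨w, hw⟩ := hX
      refine ⟨w, ?_⟩
      rw [sub_eq_iff_eq_add] at hw
      simp only [coeff_X_one, coeff_C_succ, hu, a, hw]
      ring
    | m + 2 =>
      -- From `k` to `k + 1`, terms of degree at least two gain two powers of `x`, and `i_k` only one.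
      have h1 := (le_xOrd_iff hP hc₀ k _).mp le_rfl (m + 2)
      have h2 := X_pow_add_dvd_mul (r := 2) (by omega) h1
      rw [hk, show β + (k + 1) + 2 = β + (k + 2) + 1 by omega] at h2
      simpa [coeff_X, coeff_C, mul_comm, add_assoc] using h2
  rw [C_dvd_iff_dvd_coeff] at hdvd
  have h1 := PowerSeries.X_pow_dvd_iff.mp (hdvd m) N (by omega)
  rw [coeff_sub, map_sub, sub_eq_zero, coeff_toSeries] at h1
  rw [h1, coeff_C_mul, coeff_X]
  by_cases hm : m = 1
  · subst hm
    simp [a, PowerSeries.coeff_X_pow]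
  · simp [hm, Ne.symm hm]

end Newton

/-! ### Multinomial expansion of the recentered polynomial -/

section General

variable {ι R : Type*} [CommSemiring R]

theorem sum_pow_eq_sum_finsuppAntidiag [DecidableEq ι] (s : Finset ι) (f : ι → R) (n : ℕ) :
    (∑ i ∈ s, f i) ^ n
      = ∑ k ∈ finsuppAntidiag s n, (Nat.multinomial s k : R) * ∏ i ∈ s, f i ^ k i := by
  rw [sum_pow_eq_sum_piAntidiag, finsuppAntidiag, sum_map, ← sum_attach]
  rfl

theorem prod_monomial (s : Finset ι) (f : ι → ℕ) (c : ι → R) :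
    ∏ i ∈ s, monomial (f i) (c i) = monomial (∑ i ∈ s, f i) (∏ i ∈ s, c i) := by
  classical
  induction s using Finset.induction_on with
  | empty => simp
  | insert a s ha ih => rw [prod_insert ha, prod_insert ha, sum_insert ha, ih, monomial_mul_monomial]

theorem natCast_mul_monomial (a n : ℕ) (c : R) :
    (a : R[X]) * monomial n c = monomial n ((a : R) * c) := by
  rw [← C_eq_natCast, C_mul_monomial]

end General

section Expansion

variable {K : Type*} [Field K]

/-- The integer `j! / (m! L!)` attached to an index, as a product of two multinomials. -/
def indexMultinomial (k : ℕ) (x : TermIndex) : ℕ :=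
  x.j.choose x.m * Nat.multinomial (Icc 1 (k + 1)) x.L

/-- The contribution `j! / (m! L!) a_{i,j} C^L` of an index `(l, m, i, j, L)` to the coefficient of
`x^(l + i_k) v^m` in `P_k(x, c_{k+1} + v)`. -/
noncomputable def termCoeff (P : K[X][Y]) (y₀ : PowerSeries K) (k : ℕ) (x : TermIndex) : K :=
  indexMultinomial k x * (P.coeff x.j).coeff x.i * cPow y₀ k x.L

theorem mem_termIndices {dx dy k ik : ℕ} {x : TermIndex} :
    x ∈ termIndices dx dy k ik ↔ 1 ≤ x.l ∧ x.i ≤ dx ∧ x.j ≤ dy ∧ x.m ≤ x.j ∧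
      x.L ∈ finsuppAntidiag (Icc 1 (k + 1)) (x.j - x.m) ∧
      x.i + wt k x.L + x.m * (k + 1) = x.l + ik := by
  obtain ⟨l, m, i, j, L⟩ := x
  simp only [termIndices, mem_biUnion, mem_image, mem_filter, mem_Icc, TermIndex.mk.injEq]
  constructor
  · rintro ⟨l', ⟨hl, -⟩, m', ⟨-, hm⟩, i', ⟨-, hi⟩, j', ⟨hmj, hj⟩, L', ⟨hL, hw⟩,
      rfl, rfl, rfl, rfl, rfl⟩
    refine ⟨hl, hi, hj, hmj, hL, ?_⟩
    zify
    linarith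
  · rintro ⟨hl, hi, hj, hmj, hL, hw⟩
    have hwL : wt k L ≤ (k + 1) * (j - m) := by
      rw [← (mem_finsuppAntidiag.mp hL).1, mul_sum, wt]
      exact sum_le_sum fun r hr => Nat.mul_le_mul_right _ (mem_Icc.mp hr).2
    have hjm : (k + 1) * (j - m) + m * (k + 1) ≤ (k + 1) * dy := by
      rw [mul_comm m, ← mul_add, Nat.sub_add_cancel hmj]
      exact Nat.mul_le_mul_left _ hj
    refine ⟨l, ⟨hl, by omega⟩, m, ⟨Nat.zero_le _, le_min ?_ (hmj.trans hj)⟩, i,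
      ⟨Nat.zero_le _, hi⟩, j, ⟨hmj, hj⟩, L, ⟨hL, ?_⟩, rfl, rfl, rfl, rfl, rfl⟩
    · rw [Nat.le_div_iff_mul_le (by omega)]
      omega
    · zify at hw
      linarith

theorem trunc_pow (y₀ : PowerSeries K) (k n : ℕ) :
    trunc y₀ (k + 1) ^ n = ∑ L ∈ finsuppAntidiag (Icc 1 (k + 1)) n,
      monomial (wt k L) ((Nat.multinomial (Icc 1 (k + 1)) L : K) * cPow y₀ k L) := by
  rw [trunc, sum_pow_eq_sum_finsuppAntidiag]
  refine sum_congr rfl fun L _ => ?_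
  simp only [monomial_pow, prod_monomial, natCast_mul_monomial, wt, cPow]

/-- The full multinomial expansion of `P(x, z_{k+1} + x^(k+1) v)`. The entry `l` of an index, which
`termCoeff` does not involve, is set to `0`. -/
theorem recentered_eq_sum {dx dy : ℕ} {P : K[X][Y]} (hdy : P.natDegree ≤ dy)
    (hdx : ∀ j, (P.coeff j).natDegree ≤ dx) (y₀ : PowerSeries K) (k : ℕ) :
    recentered P y₀ k = ∑ j ∈ range (dy + 1), ∑ i ∈ range (dx + 1), ∑ m ∈ range (j + 1),
      ∑ L ∈ finsuppAntidiag (Icc 1 (k + 1)) (j - m),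
        monomial m (monomial (i + wt k L + m * (k + 1)) (termCoeff P y₀ k ⟨0, m, i, j, L⟩)) := by
  rw [recentered, comp, eval₂_eq_sum_range' C (Nat.lt_succ_of_le hdy)]
  refine sum_congr rfl fun j _ => ?_
  conv_lhs => rw [as_sum_range' (P.coeff j) (dx + 1) (Nat.lt_succ_of_le (hdx j)), map_sum, sum_mul]
  refine sum_congr rfl fun i _ => ?_
  rw [add_comm, add_pow, mul_sum]
  refine sum_congr rfl fun m _ => ?_
  rw [← C_pow (a := trunc y₀ (k + 1)), trunc_pow, map_sum, mul_sum, sum_mul, mul_sum]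
  refine sum_congr rfl fun L _ => ?_
  rw [C_mul_X_eq_monomial, monomial_pow, ← pow_mul, X_pow_eq_monomial, monomial_mul_C,
    monomial_mul_monomial, mul_comm _ ((_ : ℕ) : K[X][Y]), natCast_mul_monomial,
    natCast_mul_monomial, C_mul_monomial, monomial_mul_monomial, termCoeff, indexMultinomial]
  rw [one_mul m]
  congr 2
  · congr 1
    ring
  · dsimp only
    push_cast
    ring

/-- If the terms of `P_k(x, c_{k+1} + v)` of `x`-degree at most `i_k` amount to `ω x^(i_k) v`, then
the remaining ones are indexed by `termIndices`. -/
theorem recentered_eq_add_sum {dx dy : ℕ} {P : K[X][Y]} (hdy : P.natDegree ≤ dy)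
    (hdx : ∀ j, (P.coeff j).natDegree ≤ dx) (y₀ : PowerSeries K) {k ik : ℕ} {ω : K}
    (h : ∀ N ≤ ik, ∀ m, ((recentered P y₀ k).coeff m).coeff N
      = if m = 1 ∧ N = ik then ω else 0) :
    recentered P y₀ k = monomial 1 (monomial ik ω)
      + ∑ x ∈ termIndices dx dy k ik, monomial x.m (monomial (x.l + ik) (termCoeff P y₀ k x)) := by
  have hF := recentered_eq_sum hdy hdx y₀ k
  set F := recentered P y₀ k
  simp only [sum_sigma'] at hF
  rw [← sum_filter_add_sum_filter_not _
    (fun g => ik < g.2.1 + wt k g.2.2.2 + g.2.2.1 * (k + 1))] at hF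
  rw [sum_nbij' (s := filter _ _) (t := termIndices dx dy k ik)
    (g := fun x => monomial x.m (monomial (x.l + ik) (termCoeff P y₀ k x)))
    (fun g => ⟨g.2.1 + wt k g.2.2.2 + g.2.2.1 * (k + 1) - ik, g.2.2.1, g.2.1, g.1, g.2.2.2⟩)
    (fun x => ⟨x.j, x.i, x.m, x.L⟩)] at hF
  · rw [hF, add_comm]
    congr 1
    ext m N
    rw [coeff_monomial]
    by_cases hN : N ≤ ik
    · have h1 := h N hN m
      rw [hF, coeff_add, coeff_add] at h1
      have h2 : ((∑ x ∈ termIndices dx dy k ik,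
          monomial x.m (monomial (x.l + ik) (termCoeff P y₀ k x))).coeff m).coeff N = 0 := by
        simp only [finsetSum_coeff]
        refine sum_eq_zero fun x hx => ?_
        have := (mem_termIndices.mp hx).1
        rw [coeff_monomial]
        split_ifs
        · rw [coeff_monomial, if_neg (by omega)]
        · rw [coeff_zero]
      rw [h2, zero_add] at h1
      rw [h1]
      by_cases hm : 1 = m
      · subst hm; simp [coeff_monomial, eq_comm]
      · simp [hm, Ne.symm hm]
    · simp only [finsetSum_coeff]
      rw [sum_eq_zero]
      · split_ifs
        · rw [coeff_monomial, if_neg (by omega)]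
        · rw [coeff_zero]
      · intro g hg
        have := (mem_filter.mp hg).2
        rw [coeff_monomial]
        split_ifs
        · rw [coeff_monomial, if_neg (by omega)]
        · rw [coeff_zero]
  · rintro ⟨j, i, m, L⟩ hg
    simp only [mem_filter, mem_sigma, mem_range] at hg
    rw [mem_termIndices]
    exact ⟨by dsimp only; omega, by dsimp only; omega, by dsimp only; omega, by dsimp only; omega,
      hg.1.2.2.2, by dsimp only; omega⟩
  · intro x hx
    rw [mem_termIndices] at hx
    simp only [mem_filter, mem_sigma, mem_range]
    exact ⟨⟨by omega, by omega, by omega, hx.2.2.2.2.1⟩, by omega⟩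
  · intro g _
    rfl
  · intro x hx
    rw [mem_termIndices] at hx
    obtain ⟨l, m, i, j, L⟩ := x
    simp only [TermIndex.mk.injEq, and_true]
    dsimp only at hx
    omega
  · rintro ⟨j, i, m, L⟩ hg
    have := (mem_filter.mp hg).2
    dsimp only at this ⊢
    rw [Nat.sub_add_cancel this.le]
    rfl

end Expansion

/-! ### Collecting the families by their exponent vectors -/

section Weights

theorem wt_sum_smul {ι : Type*} (k : ℕ) (s : Finset ι) (n : ι → ℕ) (L : ι → ℕ →₀ ℕ) :
    wt k (∑ x ∈ s, n x • L x) = ∑ x ∈ s, n x * wt k (L x) := by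
  simp only [wt, Finsupp.finsetSum_apply, Finsupp.smul_apply, smul_eq_mul, mul_sum]
  rw [sum_comm]
  exact sum_congr rfl fun _ _ => sum_congr rfl fun _ _ => by ring

theorem sum_range_range_ite {M : Type*} [AddCommMonoid M] {dx dy i j : ℕ} (hi : i ≤ dx)
    (hj : j ≤ dy) (f : ℕ → ℕ → M) :
    ∑ a ∈ range (dx + 1), ∑ b ∈ range (dy + 1), (if (i, j) = (a, b) then f a b else 0) = f i j := by
  rw [sum_eq_single_of_mem i (mem_range.mpr (by omega)), sum_eq_single_of_mem j
    (mem_range.mpr (by omega))]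
  · simp
  · intro b _ hb
    rw [if_neg (by simp [hb.symm])]
  · intro a _ ha
    exact sum_eq_zero fun b _ => by rw [if_neg (by simp [ha.symm])]

/-- The vector `S` of a family `n`, with entries `s_{i,j} = ∑ n^{l,m}_{i,j,L}`. -/
noncomputable def sVector (I : Finset TermIndex) (n : TermIndex →₀ ℕ) : ℕ × ℕ →₀ ℕ :=
  ∑ x ∈ I, n x • Finsupp.single (x.i, x.j) 1

/-- The vector `T` of a family `n`, equal to `∑ n^{l,m}_{i,j,L} L`. -/
noncomputable def tVector (I : Finset TermIndex) (n : TermIndex →₀ ℕ) : ℕ →₀ ℕ :=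
  ∑ x ∈ I, n x • x.L

theorem sVector_apply (I : Finset TermIndex) (n : TermIndex →₀ ℕ) (a : ℕ × ℕ) :
    sVector I n a = ∑ x ∈ I, if (x.i, x.j) = a then n x else 0 := by
  simp [sVector, Finsupp.finsetSum_apply, Finsupp.single_apply]

theorem sum_sVector {I : Finset TermIndex} {dx dy : ℕ} (hI : ∀ x ∈ I, x.i ≤ dx ∧ x.j ≤ dy)
    (n : TermIndex →₀ ℕ) (w : ℕ → ℕ → ℕ) :
    ∑ i ∈ range (dx + 1), ∑ j ∈ range (dy + 1), w i j * sVector I n (i, j)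
      = ∑ x ∈ I, n x * w x.i x.j := by
  simp only [sVector_apply, mul_sum]
  rw [sum_congr rfl fun i _ => sum_comm, sum_comm]
  refine sum_congr rfl fun x hx => ?_
  rw [← sum_range_range_ite (hI x hx).1 (hI x hx).2 fun i j => n x * w i j]
  refine sum_congr rfl fun i _ => sum_congr rfl fun j _ => ?_
  rw [mul_ite, mul_zero, mul_comm]

theorem aPow_sVector {K : Type*} [Field K] (P : K[X][Y]) {I : Finset TermIndex} {dx dy : ℕ}
    (hI : ∀ x ∈ I, x.i ≤ dx ∧ x.j ≤ dy) (n : TermIndex →₀ ℕ) :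
    aPow P dx dy (sVector I n) = ∏ x ∈ I, ((P.coeff x.j).coeff x.i) ^ n x := by
  simp only [aPow, sVector_apply, ← prod_pow_eq_pow_sum]
  rw [prod_congr rfl fun i _ => prod_comm, prod_comm]
  refine prod_congr rfl fun x hx => ?_
  -- The product over `(i, j)` collapses like the sum in `sum_range_range_ite`, written additively.
  have := sum_range_range_ite (M := Additive K) (hI x hx).1 (hI x hx).2
    fun i j => Additive.ofMul (((P.coeff j).coeff i) ^ n x)
  rw [show ((P.coeff x.j).coeff x.i) ^ n x = _ from congrArg Additive.toMul this.symm]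
  simp only [toMul_sum]
  refine prod_congr rfl fun i _ => prod_congr rfl fun j _ => ?_
  split_ifs <;> simp

theorem cPow_tVector {K : Type*} [Field K] (y₀ : PowerSeries K) (k : ℕ) (I : Finset TermIndex)
    (n : TermIndex →₀ ℕ) : cPow y₀ k (tVector I n) = ∏ x ∈ I, cPow y₀ k x.L ^ n x := by
  simp only [cPow, tVector, Finsupp.finsetSum_apply, Finsupp.smul_apply, smul_eq_mul,
    ← prod_pow_eq_pow_sum, ← prod_pow]
  rw [prod_comm]
  exact prod_congr rfl fun _ _ => prod_congr rfl fun _ _ => by rw [← pow_mul, mul_comm]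

end Weights

section Families

variable {dx dy k ik : ℕ}

theorem sVector_mem_finsuppAntidiag {q : ℕ} {n : TermIndex →₀ ℕ}
    (hn : n ∈ finsuppAntidiag (termIndices dx dy k ik) q) :
    sVector (termIndices dx dy k ik) n
      ∈ finsuppAntidiag (range (dx + 1) ×ˢ range (dy + 1)) q := by
  have hI : ∀ x ∈ termIndices dx dy k ik, x.i ≤ dx ∧ x.j ≤ dy := fun x hx =>
    ⟨(mem_termIndices.mp hx).2.1, (mem_termIndices.mp hx).2.2.1⟩
  rw [mem_finsuppAntidiag]
  constructor
  · have := sum_sVector hI n fun _ _ => 1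
    simp only [one_mul, mul_one] at this
    rw [sum_product, this, (mem_finsuppAntidiag.mp hn).1]
  · rintro ⟨i, j⟩ h
    rw [Finsupp.mem_support_iff, sVector_apply] at h
    obtain ⟨x, hx, h⟩ := exists_ne_zero_of_sum_ne_zero h
    have h' := (ite_ne_right_iff.mp h).1
    have := hI x hx
    simp only [Prod.mk.injEq] at h'
    simp only [mem_product, mem_range]
    omega

theorem mem_families {q : ℕ} {S : ℕ × ℕ →₀ ℕ} {T : ℕ →₀ ℕ} {n : TermIndex →₀ ℕ}
    (hS : S.support ⊆ range (dx + 1) ×ˢ range (dy + 1)) :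
    n ∈ families dx dy k ik q S T ↔ n ∈ finsuppAntidiag (termIndices dx dy k ik) q ∧
      sVector (termIndices dx dy k ik) n = S ∧ tVector (termIndices dx dy k ik) n = T := by
  simp only [families, mem_filter, tVector]
  refine and_congr_right fun hn => and_congr_left fun _ => ?_
  have key : ∀ i j, ∑ x ∈ (termIndices dx dy k ik).filter (fun x => x.i = i ∧ x.j = j), n x
      = sVector (termIndices dx dy k ik) n (i, j) := fun i j => by
    simp [sVector_apply, sum_filter]
  simp only [key, mem_Icc]
  constructor
  · intro h
    ext ⟨i, j⟩
    by_cases hij : (i, j) ∈ range (dx + 1) ×ˢ range (dy + 1)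
    · simp only [mem_product, mem_range] at hij
      exact h i (by omega) j (by omega)
    · rw [Finsupp.notMem_support_iff.mp fun h' => hij (hS h'), Finsupp.notMem_support_iff.mp
        fun h' => hij ((mem_finsuppAntidiag.mp (sVector_mem_finsuppAntidiag hn)).2 h')]
  · rintro h i - j -
    rw [h]

/-- The conditions on `|T|` and `‖T‖` say that `∑ n m = q - 1` and `∑ n l = p`. -/
theorem vectors_mem_iff {p q : ℕ} (hq : 1 ≤ q) {n : TermIndex →₀ ℕ}
    (hn : n ∈ finsuppAntidiag (termIndices dx dy k ik) q) :
    (sVector (termIndices dx dy k ik) n ∈ sIndices dx dy q ∧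
      tVector (termIndices dx dy k ik) n
        ∈ tIndices dx dy k ik p q (sVector (termIndices dx dy k ik) n)) ↔
    (∑ x ∈ termIndices dx dy k ik, n x * x.m = q - 1 ∧
      ∑ x ∈ termIndices dx dy k ik, n x * x.l = p) := by
  set I := termIndices dx dy k ik with hIdef
  have hmem : ∀ x ∈ I, _ := fun x hx => mem_termIndices.mp hx
  have hI : ∀ x ∈ I, x.i ≤ dx ∧ x.j ≤ dy := fun x hx => ⟨(hmem x hx).2.1, (hmem x hx).2.2.1⟩
  have h1 : wt₁ dx dy (sVector I n) = ∑ x ∈ I, n x * x.i := sum_sVector hI n fun i _ => i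
  have h2 : wt₂ dx dy (sVector I n) = ∑ x ∈ I, n x * x.j := sum_sVector hI n fun _ j => j
  have h3 : wt k (tVector I n) = ∑ x ∈ I, n x * wt k x.L := wt_sum_smul k I n _
  have h4 : (Icc 1 (k + 1)).sum (tVector I n) + ∑ x ∈ I, n x * x.m = ∑ x ∈ I, n x * x.j := by
    change ∑ r ∈ Icc 1 (k + 1), tVector I n r + _ = _
    simp only [tVector, Finsupp.finsetSum_apply, Finsupp.smul_apply, smul_eq_mul]
    rw [sum_comm, ← sum_add_distrib]
    refine sum_congr rfl fun x hx => ?_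
    rw [← mul_sum, (mem_finsuppAntidiag.mp (hmem x hx).2.2.2.2.1).1, ← mul_add,
      Nat.sub_add_cancel (hmem x hx).2.2.2.1]
  have h5 : (tVector I n).support ⊆ Icc 1 (k + 1) := by
    intro r hr
    rw [Finsupp.mem_support_iff, tVector, Finsupp.finsetSum_apply] at hr
    obtain ⟨x, hx, h⟩ := exists_ne_zero_of_sum_ne_zero hr
    refine (mem_finsuppAntidiag.mp (hmem x hx).2.2.2.2.1).2 (Finsupp.mem_support_iff.mpr ?_)
    intro h0
    simp [h0] at h
  have h6 : ∑ x ∈ I, n x * x.i + ∑ x ∈ I, n x * wt k x.L + (∑ x ∈ I, n x * x.m) * (k + 1)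
      = ∑ x ∈ I, n x * x.l + q * ik := by
    rw [← (mem_finsuppAntidiag.mp hn).1, sum_mul, sum_mul, ← sum_add_distrib, ← sum_add_distrib,
      ← sum_add_distrib]
    refine sum_congr rfl fun x hx => ?_
    rw [← mul_add, ← mul_add, mul_assoc, ← mul_add, (hmem x hx).2.2.2.2.2]
  rw [sIndices, tIndices, mem_filter, mem_filter, mem_finsuppAntidiag (s := Icc 1 (k + 1)), h1, h2,
    h3]
  generalize (Icc 1 (k + 1)).sum (tVector I n) = t at *
  generalize ∑ x ∈ I, n x * x.i = a at *
  generalize ∑ x ∈ I, n x * x.j = b at *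
  generalize ∑ x ∈ I, n x * x.m = c at *
  generalize ∑ x ∈ I, n x * x.l = d at *
  generalize ∑ x ∈ I, n x * wt k x.L = w at *
  constructor
  · rintro ⟨⟨-, hs⟩, ⟨ht, -⟩, hw⟩
    have hm : c = q - 1 := by omega
    refine ⟨hm, ?_⟩
    rw [hm] at h6
    zify [hq] at h6 ⊢
    linarith
  · rintro ⟨hm, hl⟩
    refine ⟨⟨sVector_mem_finsuppAntidiag hn, by omega⟩, ⟨by omega, h5⟩, ?_⟩
    rw [hm, hl] at h6
    zify [hq] at h6
    linarith

/-- Summing over `S`, `T` and the families belonging to them amounts to summing over the families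
with `∑ n m = q - 1` and `∑ n l = p`. -/
theorem sum_families {M : Type*} [AddCommMonoid M] {p q : ℕ} (hq : 1 ≤ q)
    (f : (TermIndex →₀ ℕ) → M) :
    ∑ S ∈ sIndices dx dy q, ∑ T ∈ tIndices dx dy k ik p q S, ∑ n ∈ families dx dy k ik q S T, f n
      = ∑ n ∈ finsuppAntidiag (termIndices dx dy k ik) q with
          ∑ x ∈ termIndices dx dy k ik, n x * x.m = q - 1 ∧
          ∑ x ∈ termIndices dx dy k ik, n x * x.l = p, f n := by
  classical
  set I := termIndices dx dy k ik
  rw [← sum_fiberwise_of_maps_to (t := sIndices dx dy q) (g := sVector I)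
    fun n hn => ((vectors_mem_iff hq (mem_filter.mp hn).1).mpr (mem_filter.mp hn).2).1]
  refine sum_congr rfl fun S hS => ?_
  rw [← sum_fiberwise_of_maps_to (t := tIndices dx dy k ik p q S) (g := tVector I)]
  · refine sum_congr rfl fun T hT => sum_congr ?_ fun _ _ => rfl
    ext n
    rw [mem_families (mem_finsuppAntidiag.mp (mem_filter.mp hS).1).2]
    simp only [mem_filter]
    constructor
    · rintro ⟨hn, rfl, rfl⟩
      exact ⟨⟨⟨hn, (vectors_mem_iff hq hn).mp ⟨hS, hT⟩⟩, rfl⟩, rfl⟩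
    · rintro ⟨⟨⟨hn, -⟩, hS'⟩, hT'⟩
      exact ⟨hn, hS', hT'⟩
  · intro n hn
    rw [mem_filter, mem_filter] at hn
    obtain ⟨⟨hn, h⟩, rfl⟩ := hn
    exact ((vectors_mem_iff hq hn).mpr h).2

theorem div_eq_indexMultinomial {x : TermIndex} (hx : x ∈ termIndices dx dy k ik) :
    (x.j ! : ℚ) / ((x.m ! : ℚ) * ∏ r ∈ Icc 1 (k + 1), ((x.L r)! : ℚ)) = indexMultinomial k x := by
  obtain ⟨-, -, -, hmj, hL, -⟩ := mem_termIndices.mp hx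
  have h1 := Nat.multinomial_spec (Icc 1 (k + 1)) x.L
  rw [(mem_finsuppAntidiag.mp hL).1] at h1
  have h2 := Nat.choose_mul_factorial_mul_factorial hmj
  rw [← h1] at h2
  rw [div_eq_iff (by positivity), ← h2, indexMultinomial]
  push_cast
  ring

/-- The coefficient `e_{S,T}` counts weighted families, hence is a natural number. -/
theorem eCoeff_eq_natCast (q : ℕ) (S : ℕ × ℕ →₀ ℕ) (T : ℕ →₀ ℕ) :
    eCoeff dx dy k ik q S T = ((∑ n ∈ families dx dy k ik q S T,
      Nat.multinomial (termIndices dx dy k ik) n *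
        ∏ x ∈ termIndices dx dy k ik, indexMultinomial k x ^ n x : ℕ) : ℚ) := by
  rw [eCoeff]
  push_cast
  refine sum_congr rfl fun n hn => ?_
  simp only [families, mem_filter] at hn
  congr 1
  · have h := Nat.multinomial_spec (termIndices dx dy k ik) n
    rw [(mem_finsuppAntidiag.mp hn.1).1] at h
    rw [div_eq_iff (by positivity), ← h]
    push_cast
    ring
  · exact prod_congr rfl fun x hx => by rw [div_eq_indexMultinomial hx]

/-- The sum over `S` and `T` in the formula is the sum over the admissible families of the terms of
the multinomial expansion. -/
theorem sum_eCoeff {K : Type*} [Field K] [CharZero K] (P : K[X][Y]) (y₀ : PowerSeries K) {p q : ℕ}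
    (hq : 1 ≤ q) :
    ∑ S ∈ sIndices dx dy q, aPow P dx dy S * ∑ T ∈ tIndices dx dy k ik p q S,
        (eCoeff dx dy k ik q S T : K) * cPow y₀ k T
      = ∑ n ∈ finsuppAntidiag (termIndices dx dy k ik) q with
          ∑ x ∈ termIndices dx dy k ik, n x * x.m = q - 1 ∧
          ∑ x ∈ termIndices dx dy k ik, n x * x.l = p,
        (Nat.multinomial (termIndices dx dy k ik) n : K) *
          ∏ x ∈ termIndices dx dy k ik, termCoeff P y₀ k x ^ n x := by
  rw [← sum_families hq]
  refine sum_congr rfl fun S hS => ?_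
  rw [mul_sum]
  refine sum_congr rfl fun T _ => ?_
  rw [eCoeff_eq_natCast, Rat.cast_natCast, Nat.cast_sum, sum_mul, mul_sum]
  refine sum_congr rfl fun n hn => ?_
  obtain ⟨-, rfl, rfl⟩ :=
    (mem_families (mem_finsuppAntidiag.mp (mem_filter.mp hS).1).2).mp hn
  rw [aPow_sVector P fun x hx => ⟨(mem_termIndices.mp hx).2.1, (mem_termIndices.mp hx).2.2.1⟩,
    cPow_tVector]
  simp only [termCoeff, mul_pow, prod_mul_distrib]
  push_cast
  ring

end Families

/-! ### The coefficients of the root -/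

section Root

variable {K : Type*} [Field K]

/-- The polynomial `Q(x, v)`, namely `-1 / ω` times the terms of positive `x`-degree of
`P_k(x, c_{k+1} + v) / x^(i_k)`; the remainder of the root is a fixed point of it. -/
noncomputable def fixedPointPoly (P : K[X][Y]) (y₀ : PowerSeries K) (dx dy k ik : ℕ) (ω : K) :
    K[X][Y] :=
  ∑ x ∈ termIndices dx dy k ik, monomial x.m (monomial x.l (-1 / ω * termCoeff P y₀ k x))

theorem coeff_fixedPointPoly_pow [CharZero K] (P : K[X][Y]) (y₀ : PowerSeries K)
    (dx dy k ik : ℕ) (ω : K) (p : ℕ) {q : ℕ} (hq : 1 ≤ q) :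
    ((fixedPointPoly P y₀ dx dy k ik ω ^ q).coeff (q - 1)).coeff p
      = (-1 / ω) ^ q * ∑ S ∈ sIndices dx dy q, aPow P dx dy S *
          ∑ T ∈ tIndices dx dy k ik p q S, (eCoeff dx dy k ik q S T : K) * cPow y₀ k T := by
  rw [sum_eCoeff P y₀ hq, sum_filter, mul_sum, fixedPointPoly, sum_pow_eq_sum_finsuppAntidiag]
  simp only [finsetSum_coeff]
  refine sum_congr rfl fun n hn => ?_
  simp only [monomial_pow, prod_monomial, natCast_mul_monomial, coeff_monomial, mul_pow,
    prod_mul_distrib, prod_pow_eq_pow_sum, (mem_finsuppAntidiag.mp hn).1]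
  simp only [mul_comm (_ : ℕ) (n _)]
  by_cases h1 : ∑ x ∈ termIndices dx dy k ik, n x * x.m = q - 1
  · by_cases h2 : ∑ x ∈ termIndices dx dy k ik, n x * x.l = p
    · simp only [h1, h2, and_self, if_true, coeff_monomial]
      ring
    · simp [h1, h2, coeff_monomial]
  · simp [h1]

/-- The remainder `v = ∑_{p ≥ 1} c_{k+1+p} x^p` is a fixed point of `fixedPointPoly`. -/
theorem eval_fixedPointPoly {dx dy : ℕ} {P : K[X][Y]} {y₀ : PowerSeries K}
    (hc₀ : PowerSeries.coeff 0 y₀ = 0) (hroot : subst P y₀ = 0) {k ik : ℕ} {ω : K} (hω : ω ≠ 0)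
    (h : recentered P y₀ k = monomial 1 (monomial ik ω)
      + ∑ x ∈ termIndices dx dy k ik, monomial x.m (monomial (x.l + ik) (termCoeff P y₀ k x))) :
    (toSeries (fixedPointPoly P y₀ dx dy k ik ω)).eval (PowerSeries.X * tail y₀ (k + 2))
      = PowerSeries.X * tail y₀ (k + 2) := by
  have hfac : recentered P y₀ k
      = C (monomial ik ω) * (X - fixedPointPoly P y₀ dx dy k ik ω) := by
    rw [h, mul_sub, C_mul_X_eq_monomial, fixedPointPoly, mul_sum, sub_eq_add_neg,
      ← sum_neg_distrib]
    congr 1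
    refine sum_congr rfl fun x _ => ?_
    rw [C_mul_monomial, monomial_mul_monomial, ← map_neg, ← map_neg, add_comm]
    congr 2
    field_simp
  have hev := eval_recentered P y₀ hc₀ k
  rw [hroot, hfac, toSeries, Polynomial.map_mul, Polynomial.map_sub, map_C, map_X, eval_mul,
    eval_C, eval_sub, eval_X, mul_eq_zero] at hev
  rcases hev with hev | hev
  · exfalso
    have := congrArg (PowerSeries.coeff ik) hev
    simp [hω] at this
  · exact (sub_eq_zero.mp hev).symm

theorem exists_fixedPointPoly_eq (P : K[X][Y]) (y₀ : PowerSeries K) (dx dy k ik : ℕ) (ω : K) :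
    ∃ Q₁ : (PowerSeries K)[X],
      toSeries (fixedPointPoly P y₀ dx dy k ik ω) = C PowerSeries.X * Q₁ := by
  change C (PowerSeries.X : PowerSeries K) ∣ _
  rw [C_dvd_iff_dvd_coeff]
  intro m
  rw [PowerSeries.X_dvd_iff, ← PowerSeries.coeff_zero_eq_constantCoeff_apply, coeff_toSeries,
    fixedPointPoly]
  simp only [finsetSum_coeff]
  refine sum_eq_zero fun x hx => ?_
  have := (mem_termIndices.mp hx).1
  rw [coeff_monomial]
  split_ifs
  · rw [coeff_monomial, if_neg (by omega)]
  · rw [coeff_zero]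

theorem coeff_root_eq_sum [CharZero K] {dx dy : ℕ} {P : K[X][Y]} {y₀ : PowerSeries K}
    (hc₀ : PowerSeries.coeff 0 y₀ = 0) (hroot : subst P y₀ = 0) {k ik : ℕ} {ω : K} (hω : ω ≠ 0)
    (h : recentered P y₀ k = monomial 1 (monomial ik ω)
      + ∑ x ∈ termIndices dx dy k ik, monomial x.m (monomial (x.l + ik) (termCoeff P y₀ k x)))
    {p : ℕ} (hp : 1 ≤ p) :
    PowerSeries.coeff (k + 1 + p) y₀
      = ∑ q ∈ Icc 1 p, (1 / (q : K)) * (-1 / ω) ^ q *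
          ∑ S ∈ sIndices dx dy q, aPow P dx dy S *
            ∑ T ∈ tIndices dx dy k ik p q S, (eCoeff dx dy k ik q S T : K) * cPow y₀ k T := by
  obtain ⟨Q₁, hQ₁⟩ := exists_fixedPointPoly_eq P y₀ dx dy k ik ω
  have hfix := eval_fixedPointPoly hc₀ hroot hω h
  rw [hQ₁] at hfix
  have hL := pow_dvd_sub_sum_lagrange PowerSeries.X _ Q₁ hfix (p + 1)
  have hcoeff := PowerSeries.X_pow_dvd_iff.mp hL p (Nat.lt_succ_self p)
  rw [map_sub, sub_eq_zero, ← hQ₁, map_sum, range_eq_Ico, sum_eq_sum_Ico_succ_bot (by omega)]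
    at hcoeff
  obtain ⟨p, rfl⟩ := Nat.exists_eq_succ_of_ne_zero (by omega : p ≠ 0)
  rw [Nat.succ_eq_add_one, PowerSeries.coeff_succ_X_mul, tail, PowerSeries.coeff_mk] at hcoeff
  rw [show k + 1 + (p + 1) = p + (k + 2) by omega, hcoeff]
  simp only [Nat.cast_zero, div_zero, zero_smul, map_zero, zero_add]
  refine sum_congr (by ext; simp) fun q hq => ?_
  obtain ⟨hq, -⟩ := mem_Icc.mp hq
  have hX : (X * toSeries (fixedPointPoly P y₀ dx dy k ik ω) ^ q).coeff q
      = (toSeries (fixedPointPoly P y₀ dx dy k ik ω ^ q)).coeff (q - 1) := by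
    obtain ⟨q, rfl⟩ := Nat.exists_eq_succ_of_ne_zero (by omega : q ≠ 0)
    rw [coeff_X_mul, toSeries, toSeries, Polynomial.map_pow, Nat.succ_sub_one]
  rw [mul_assoc, ← coeff_fixedPointPoly_pow P y₀ dx dy k ik ω (p + 1) hq, hX,
    ← coeff_toSeries, Algebra.smul_def, PowerSeries.algebraMap_apply, PowerSeries.coeff_C_mul]
  simp

end Root

end AlgSeries

theorem corollary4p6 {K : Type*} [Field K] [CharZero K] (dx dy : ℕ) (P : K[X][Y])
    (hdy : P.natDegree ≤ dy) (hdx : ∀ j, (P.coeff j).natDegree ≤ dx)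
    (y₀ : PowerSeries K) (hc₀ : PowerSeries.coeff 0 y₀ = 0) (hc₁ : PowerSeries.coeff 1 y₀ ≠ 0)
    (hroot : AlgSeries.IsSimpleRoot P y₀) :
    ∃ k₀ : ℕ,
      IsLeast {k : ℕ | AlgSeries.xOrd P y₀ (k + 1) = AlgSeries.xOrd P y₀ k + 1} k₀ ∧
      AlgSeries.omega P y₀ k₀ ≠ 0 ∧
      ∀ k : ℕ, k₀ + 1 ≤ k → ∀ p : ℕ, 1 ≤ p →
        (∀ q ∈ Finset.Icc 1 p, ∀ S ∈ AlgSeries.sIndices dx dy q,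
          ∀ T ∈ AlgSeries.tIndices dx dy k (AlgSeries.xOrd P y₀ k) p q S,
            ∃ e : ℕ, AlgSeries.eCoeff dx dy k (AlgSeries.xOrd P y₀ k) q S T = (e : ℚ)) ∧
        PowerSeries.coeff (k + 1 + p) y₀ =
          ∑ q ∈ Finset.Icc 1 p, (1 / (q : K)) * (-1 / AlgSeries.omega P y₀ k₀) ^ q *
            ∑ S ∈ AlgSeries.sIndices dx dy q, AlgSeries.aPow P dx dy S *
              ∑ T ∈ AlgSeries.tIndices dx dy k (AlgSeries.xOrd P y₀ k) p q S,
                (AlgSeries.eCoeff dx dy k (AlgSeries.xOrd P y₀ k) q S T : K) *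
                  AlgSeries.cPow y₀ k T := by
  classical
  obtain ⟨h₀, h₁⟩ := hroot
  have hP : P ≠ 0 := by
    rintro rfl
    simp [AlgSeries.subst] at h₁
  have hb₀ : AlgSeries.taylorSeries P y₀ 0 = 0 := by rw [AlgSeries.taylorSeries_zero, h₀]
  rw [← AlgSeries.taylorSeries_one] at h₁
  obtain ⟨β, hd, hβ⟩ : ∃ β, PowerSeries.X ^ β ∣ AlgSeries.taylorSeries P y₀ 1 ∧
      PowerSeries.coeff β (AlgSeries.taylorSeries P y₀ 1) ≠ 0 :=
    ⟨_, PowerSeries.X_pow_order_dvd, PowerSeries.coeff_order h₁⟩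
  have hiff := AlgSeries.xOrd_succ_eq_iff hP hc₀ hb₀ hd hβ
  have hex : ∃ k, AlgSeries.xOrd P y₀ (k + 1) = AlgSeries.xOrd P y₀ k + 1 :=
    ⟨β, (hiff β).mpr (AlgSeries.xOrd_eq_of_large hP hc₀ hb₀ hd hβ)⟩
  have hk₀ := (hiff _).mp (Nat.find_spec hex)
  refine ⟨Nat.find hex, ⟨Nat.find_spec hex, fun k hk => Nat.find_min' hex hk⟩, ?_, ?_⟩
  · rwa [AlgSeries.omega_eq_coeff hP hc₀ hk₀]
  · intro k hk p hp
    refine ⟨fun q _ S _ T _ => ⟨_, AlgSeries.eCoeff_eq_natCast q S T⟩, ?_⟩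
    obtain ⟨k, rfl⟩ := Nat.exists_eq_succ_of_ne_zero (by omega : k ≠ 0)
    have hk' := AlgSeries.xOrd_eq_of_le hP hc₀ hb₀ hd hβ hk₀ (by omega : _ ≤ k)
    have hk'' := AlgSeries.xOrd_eq_of_le hP hc₀ hb₀ hd hβ hk₀ (by omega : _ ≤ k + 1)
    rw [AlgSeries.omega_eq_coeff hP hc₀ hk₀]
    refine AlgSeries.coeff_root_eq_sum hc₀ h₀ hβ
      (AlgSeries.recentered_eq_add_sum hdy hdx y₀ fun N hN m => ?_) hp
    rw [Nat.succ_eq_add_one, hk''] at hN ⊢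
    exact AlgSeries.coeff_recentered hP hc₀ hb₀ hd hk' hN m
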